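/- **Setting.** Let $\mathbb X$ be a (measurable) state space and $\mathbb A$ a finite action space. Let $\pi(s,\cdot)$, $s\in\mathbb X$, be a known policy, i.e. a probability mass function on $\mathbb A$ for each state, and let $g:\mathbb X\times\mathbb A\to\mathbb R$ be a known (measurable) weight function. For a probability law $\xi$ on $\mathbb X$ and an outcome function $\mu:\mathbb X\times\mathbb A\to\mathbb R$, one observes $n\ge 1$ i.i.d. triples $(X_i,A_i,Y_i)$ with $X_i\sim\xi$, $A_i\mid X_i\sim\pi(X_i,\cdot)$ and $\mathbb E[Y_i\mid X_i,A_i]=\mu(X_i,A_i)$, where, given $X_i=s$ and $A_i=a$, the law of $Y_i$ is $K(s,a,\mu(s,a))$ for some fixed Markov kernel $K$ (the noise model; it may be anything compatible with the mean condition for all $\mu$ in the class considered, including the noiseless model $Y_i=\mu(X_i,A_i)$). The target is $$\tau(\xi,\mu)=\sum_{a\in\mathbb A}\mathbb E_{X\sim\xi}\big[g(X,a)\,\mu(X,a)\big].$$ For a class $\mathcal F$ of outcome functions, the minimax risk is $$\mathscr M_n(\mathcal F)=\inf_{\widehat\tau_n}\ \sup_{\mu\in\mathcal F,\ \xi}\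 \mathbb E\big[|\widehat\tau_n-\tau(\xi,\mu)|^2\big],$$ where the infimum is over all estimators (possibly randomized, and allowed to depend on $\pi,g,K,\mathcal F$), and the supremum over $\mu\in\mathcal F$ and all probability laws $\xi$ on $\mathbb X$ for which $\tau(\xi,\mu)$ is well defined. A sequence $(s_j)_{j=1}^D$ in $\mathbb X$ is *shattered at scale $\delta\ge 0$* by a class $\mathcal H$ of functions $\mathbb X\to\mathbb R$ if there is a vector $t\in\mathbb R^D$ such that for every subset $S\subseteq\{1,\dots,D\}$ there is $f\in\mathcal H$ with $f(s_j)\ge t_j+\delta$ for all $j\in S$ and $f(s_j)\le t_j-\delta$ for all $j\notin S$. **Proposition.** There are universal constants $c,c'>0$ such that the following holds. Let $\mathcal F=\bigotimes_{a\in\mathbb A}\mathcal F_a=\{\mu:\ \mu(\cdot,a)\in\mathcal F_a\text{ for all }a\in\mathbb A\}$, where each $\mathcal F_a$ is a convex set of (measurable) functions $\mathbb X\to\mathbb R$. Suppose that one sequence $(s_j)_{j=1}^D$ is shattered, for each $a\in\mathbb A$, by $\mathcal F_a$ at scale $\delta_a\ge 0$, and that $g(s_j,a)=0$ whenever $\pi(s_j,a)=0$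 (in which case the quotients below are read as $0$). With $X$ uniform on $(s_j)_{j=1}^D$ and $A\mid X\sim\pi(X,\cdot)$, let $$M=\frac{\sqrt{\mathbb E[Z^4]}}{\mathbb E[Z^2]},\qquad Z=\frac{g(X,A)}{\pi(X,A)}\,\delta_A$$ (the claim is trivial if $\mathbb E[Z^2]=0$). If $n\ge M^2$ and $n\le c'D$, then $$\mathscr M_n(\mathcal F)\ \ge\ \frac cn\left\{\frac1D\sum_{j=1}^D\sum_{a\in\mathbb A}\frac{g^2(s_j,a)}{\pi(s_j,a)}\,\delta_a^2\right\}.$$ -/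

import Mathlib

open MeasureTheory ProbabilityTheory
open scoped ENNReal

/-- The points `s 0, …, s (N - 1)` are shattered by `H` at scale `δ`: there is one vector `t` of
witness levels such that for every subset `S` of the indices some `f ∈ H` is at least `t i + δ`
at the points with index in `S` and at most `t i - δ` at the others. -/
def FatShatters {X : Type*} (H : Set (X → ℝ)) (δ : ℝ) {N : ℕ} (s : Fin N → X) : Prop :=
  ∃ t : Fin N → ℝ, ∀ S : Set (Fin N), ∃ f ∈ H,
    (∀ i ∈ S, t i + δ ≤ f (s i)) ∧ (∀ i ∉ S, f (s i) ≤ t i - δ)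

/-- The product class: outcome functions whose section at each action `a` lies in `F a`. -/
def productClass {X A : Type*} (F : A → Set (X → ℝ)) : Set (X × A → ℝ) :=
  {μ | ∀ a, (fun x => μ (x, a)) ∈ F a}

/-- The `(2,4)`-moment ratio `√(E[Y⁴]) / E[Y²]` of a random variable. -/
noncomputable def momentRatio {Ω : Type*} [MeasurableSpace Ω] (P : Measure Ω) (Y : Ω → ℝ) : ℝ :=
  Real.sqrt (∫ ω, Y ω ^ 4 ∂P) / ∫ ω, Y ω ^ 2 ∂P

section Model

variable {X A : Type*} [MeasurableSpace X] [MeasurableSpace A]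

/-- The density `π(x, a)` of the policy with respect to counting measure on a finite (discrete)
action space. -/
noncomputable def propensity (π : Kernel X A) (x : X) (a : A) : ℝ := (π x).real {a}

/-- The uniform distribution over a finite sequence of states. -/
noncomputable def uniformLaw {N : ℕ} (s : Fin N → X) : Measure X :=
  (uniformOn (Set.univ : Set (Fin N))).map s

/-- The target functional `τ(ξ, μ) = ∑ₐ E_ξ[g(X, a) μ(X, a)]`. -/
noncomputable def targetFunctional [Fintype A] (g : X × A → ℝ) (ξ : Measure X)
    (μ : X × A → ℝ) : ℝ :=
  ∑ a, ∫ x, g (x, a) * μ (x, a) ∂ξ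

/-- `K (x, a, m)` is the conditional law of the outcome `Y` given `X = x`, `A = a`, when the
outcome function has the value `m` at `(x, a)`. This says that the conditional mean of `Y` is
`μ(x, a)` for every outcome function `μ` in the class `𝓕`. -/
def IsOutcomeModel (K : Kernel (X × A × ℝ) ℝ) (𝓕 : Set (X × A → ℝ)) : Prop :=
  ∀ μ ∈ 𝓕, ∀ x a, Integrable (fun y : ℝ => y) (K (x, a, μ (x, a))) ∧
    ∫ y, y ∂(K (x, a, μ (x, a))) = μ (x, a)

/-- The conditional law of `Y` given `(X, A)` under the outcome function `μ`. -/
noncomputable def outcomeKernel (K : Kernel (X × A × ℝ) ℝ) (μ : X × A → ℝ) (hμ : Measurable μ) :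
    Kernel (X × A) ℝ :=
  K.comap (fun p => (p.1, p.2, μ p)) (measurable_fst.prodMk (measurable_snd.prodMk hμ))

/-- The law of one observation `((X, A), Y)`: `X ∼ ξ`, `A ∣ X ∼ π(X, ·)`, and
`Y ∣ X, A ∼ K (X, A, μ(X, A))`. -/
noncomputable def observationLaw (π : Kernel X A) (K : Kernel (X × A × ℝ) ℝ) (ξ : Measure X)
    (μ : X × A → ℝ) (hμ : Measurable μ) : Measure ((X × A) × ℝ) :=
  (ξ ⊗ₘ π) ⊗ₘ outcomeKernel K μ hμ

/-- The problem instances `(ξ, μ)`: `ξ` is any probability law on the states, and `μ` is a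
(measurable) outcome function in `𝓕`, such that the target `τ(ξ, μ)` is well defined. -/
structure ProblemInstance (g : X × A → ℝ) (𝓕 : Set (X × A → ℝ)) where
  ξ : Measure X
  μ : X × A → ℝ
  isProbabilityMeasure : IsProbabilityMeasure ξ
  measurable : Measurable μ
  mem : μ ∈ 𝓕
  integrable : ∀ a, Integrable (fun x => g (x, a) * μ (x, a)) ξ

/-- The set of problem instances serves as a bare index set: it carries the discrete σ-algebra. -/
instance (g : X × A → ℝ) (𝓕 : Set (X × A → ℝ)) : MeasurableSpace (ProblemInstance g 𝓕) := ⊤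

/-- The law of `n` i.i.d. observations, as a function of the problem instance. -/
noncomputable def sampleLaw (n : ℕ) (π : Kernel X A) (g : X × A → ℝ)
    (K : Kernel (X × A × ℝ) ℝ) (𝓕 : Set (X × A → ℝ)) :
    Kernel (ProblemInstance g 𝓕) (Fin n → (X × A) × ℝ) where
  toFun θ := Measure.pi fun _ : Fin n => observationLaw π K θ.ξ θ.μ θ.measurable
  measurable' := measurable_from_top

/-- The minimax mean-squared error for estimating `τ(ξ, μ)` from `n` i.i.d. observations: the
infimum over all (possibly randomized) estimators, which may depend on `π`, `g`, `K` and `𝓕`, of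
the supremum over all problem instances of the mean-squared error. -/
noncomputable def minimaxMSE [Fintype A] (n : ℕ) (π : Kernel X A) (g : X × A → ℝ)
    (K : Kernel (X × A × ℝ) ℝ) (𝓕 : Set (X × A → ℝ)) : ℝ≥0∞ :=
  minimaxRisk (fun (θ : ProblemInstance g 𝓕) (t : ℝ) =>
    ENNReal.ofReal ((t - targetFunctional g θ.ξ θ.μ) ^ 2)) (sampleLaw n π g K 𝓕)

end Model

/-! Take `ξ` uniform on the shattered sequence and call a pair `(j, a)` a cell. By convexity each
class attains every point of the cube around its witness levels, so any signs `ε` on the cells give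
an outcome function with value `t a j + δ a * ε (j, a)` (`exists_mem_apply_eq_of_shatters`). The
target is then `m + ∑ v c * ε c` with `v = w Z`, where `w` is the cell mass, and the data involve
only the signs of visited cells.

Compare two priors with independent signs of means `h` and `-h`. The mean targets are `2 ∑ v h`
apart, and given the visited cells the priors overlap by at least half of `∏ (1 - h²)` over those
cells (`half_prod_le_sum_min`). Averaging over the design gives a two-point bound as long as `n ∑ w
h² ≤ 1/2`. The target also fluctuates under each prior, with variance at most `∑ v² ≤ V / D`, where
`V = ∑ w Z²`; this is negligible once `D` is a large multiple of `n` (`ofReal_le_worst_risk`).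

By Cauchy–Schwarz the best direction is `h ∝ Z`, with squared separation of order `V / n`. Means
must stay in `[-1, 1]`, so `h` is clipped; the fourth-moment condition keeps the loss small
(`exists_clipped_score`). -/

/-- The sign `±1` encoded by a Boolean. -/
def boolSign (b : Bool) : ℝ := if b then 1 else -1

/-- The probability of `b` under the law on signs with mean `x`. -/
noncomputable def signWeight (x : ℝ) (b : Bool) : ℝ := (1 + boolSign b * x) / 2

lemma signWeight_nonneg {x : ℝ} (hx : |x| ≤ 1) (b : Bool) : 0 ≤ signWeight x b := by
  have := abs_le.1 hx
  cases b <;> simp [signWeight, boolSign] <;> linarith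

lemma sum_signWeight (x : ℝ) : ∑ b, signWeight x b = 1 := by
  simp [signWeight, boolSign]; ring

/-- Independence of `b` makes the Hellinger affinity of opposite product laws explicit. -/
lemma signWeight_mul_neg (x : ℝ) (b : Bool) :
    signWeight x b * signWeight (-x) b = (1 - x ^ 2) / 4 := by
  cases b <;> simp [signWeight, boolSign] <;> ring

lemma sum_signWeight_mul_sub (v x : ℝ) :
    ∑ b, signWeight x b * (v * (boolSign b - x)) = 0 := by
  simp [signWeight, boolSign]; ring

lemma sum_signWeight_mul_sub_sq_le (v x : ℝ) :
    ∑ b, signWeight x b * (v * (boolSign b - x)) ^ 2 ≤ v ^ 2 := by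
  simp only [signWeight, boolSign, Fintype.sum_bool]
  simp only [if_true, Bool.false_eq_true, if_false]
  nlinarith [sq_nonneg (v * x)]

/-! ### Two product priors on finitely many signs -/

section FiniteBayes

variable {C : Type*} [Fintype C] [DecidableEq C]

lemma sum_fun_prod {R : Type*} [CommSemiring R] (q : C → Bool → R) :
    ∑ ε : C → Bool, ∏ c, q c (ε c) = ∏ c, ∑ b, q c b := by
  rw [Finset.prod_univ_sum, Fintype.piFinset_univ]

lemma sum_prod_signWeight (x : C → ℝ) :
    ∑ ε : C → Bool, ∏ c, signWeight (x c) (ε c) = 1 := by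
  rw [sum_fun_prod]
  exact Finset.prod_eq_one fun c _ => sum_signWeight _

/-- A sum against a product weight of a function of the coordinates in `S` only depends on the
factors with index in `S`. -/
lemma sum_prod_mul_congr {R : Type*} [CommSemiring R] (S : Finset C)
    (q q' : C → Bool → R) (hq : ∀ c, ∑ b, q c b = 1) (hq' : ∀ c, ∑ b, q' c b = 1)
    (hS : ∀ c ∈ S, q c = q' c) (f : (C → Bool) → R)
    (hf : ∀ ε ε', (∀ c ∈ S, ε c = ε' c) → f ε = f ε') :
    ∑ ε, (∏ c, q c (ε c)) * f ε = ∑ ε, (∏ c, q' c (ε c)) * f ε := by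
  -- The factors off `S` sum to one and drop out; `true` is an arbitrary filler for coordinates that
  -- `f` ignores.
  have key : ∀ r : C → Bool → R, (∀ c, ∑ b, r c b = 1) →
      ∑ ε, (∏ c, r c (ε c)) * f ε = ∑ η : {c // c ∈ S} → Bool,
        (∏ c, r c.1 (η c)) * f (fun c => if hc : c ∈ S then η ⟨c, hc⟩ else true) := by
    intro r hr
    rw [← (Equiv.piEquivPiSubtypeProd (fun c => c ∈ S) fun _ => Bool).symm.sum_comp,
      Fintype.sum_prod_type]
    refine Finset.sum_congr rfl fun η _ => ?_
    have h1 : ∀ ζ : {c // c ∉ S} → Bool,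
        (∏ c, r c ((Equiv.piEquivPiSubtypeProd (fun c => c ∈ S) fun _ => Bool).symm (η, ζ) c)) *
          f ((Equiv.piEquivPiSubtypeProd (fun c => c ∈ S) fun _ => Bool).symm (η, ζ)) =
        ((∏ c, r c.1 (η c)) * f (fun c => if hc : c ∈ S then η ⟨c, hc⟩ else true)) *
          ∏ c, r c.1 (ζ c) := by
      intro ζ
      rw [hf _ (fun c => if hc : c ∈ S then η ⟨c, hc⟩ else true)
          (fun c hc => by simp [Equiv.piEquivPiSubtypeProd, hc]),
        ← Fintype.prod_subtype_mul_prod_subtype (fun c => c ∈ S)]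
      have e1 : ∀ c : {c // c ∈ S},
          (Equiv.piEquivPiSubtypeProd (fun c => c ∈ S) fun _ => Bool).symm (η, ζ) c = η c := by
        intro c; simp [Equiv.piEquivPiSubtypeProd]
      have e2 : ∀ c : {c // c ∉ S},
          (Equiv.piEquivPiSubtypeProd (fun c => c ∈ S) fun _ => Bool).symm (η, ζ) c = ζ c := by
        intro c; simp [Equiv.piEquivPiSubtypeProd, c.2]
      simp only [e1, e2]
      convert mul_right_comm _ _ _
    rw [Finset.sum_congr rfl fun ζ _ => h1 ζ, ← Finset.mul_sum,
      sum_fun_prod (fun (c : {c // c ∉ S}) b => r c.1 b),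
      Finset.prod_eq_one (f := fun c : {c // c ∉ S} => ∑ b, r c.1 b) fun c _ => hr c.1, mul_one]
  rw [key q hq, key q' hq']
  refine Finset.sum_congr rfl fun η _ => ?_
  congr 1
  exact Finset.prod_congr rfl fun c _ => by rw [hS c.1 c.2]

/-- The affinity bound for two product laws on signs with opposite means. -/
lemma half_prod_le_sum_min (x : C → ℝ) (hx : ∀ c, |x c| ≤ 1) :
    1 / 2 * ∏ c, (1 - x c ^ 2) ≤ ∑ ε : C → Bool,
      min (∏ c, signWeight (x c) (ε c)) (∏ c, signWeight (-x c) (ε c)) := by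
  set p : (C → Bool) → ℝ := fun ε => ∏ c, signWeight (x c) (ε c)
  set q : (C → Bool) → ℝ := fun ε => ∏ c, signWeight (-x c) (ε c)
  have hp : ∀ ε, 0 ≤ p ε := fun ε => Finset.prod_nonneg fun c _ => signWeight_nonneg (hx c) _
  have hq : ∀ ε, 0 ≤ q ε := fun ε =>
    Finset.prod_nonneg fun c _ => signWeight_nonneg (by simpa using hx c) _
  have hx2 : ∀ c, 0 ≤ 1 - x c ^ 2 := fun c => by
    have := (sq_le_one_iff_abs_le_one (x c)).2 (hx c)
    linarith
  -- Cauchy–Schwarz with `p q = min * max`: the squared affinity is at most `(∑ min) (∑ max)`, and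
  -- `∑ max ≤ 2`.
  have hcs := Finset.sum_sq_le_sum_mul_sum_of_sq_le_mul (Finset.univ : Finset (C → Bool))
    (r := fun _ => ∏ c, (√(1 - x c ^ 2) / 2))
    (f := fun ε => min (p ε) (q ε)) (g := fun ε => max (p ε) (q ε))
    (fun ε _ => le_min (hp ε) (hq ε)) (fun ε _ => le_max_of_le_left (hp ε))
    (fun ε _ => le_of_eq <| by
      rw [min_mul_max, ← Finset.prod_mul_distrib, ← Finset.prod_pow]
      refine Finset.prod_congr rfl fun c _ => ?_
      rw [signWeight_mul_neg, div_pow, Real.sq_sqrt (hx2 c)]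
      norm_num)
  have hr : ∑ _ε : C → Bool, ∏ c, (√(1 - x c ^ 2) / 2) = ∏ c, √(1 - x c ^ 2) := by
    rw [sum_fun_prod (fun c _ => √(1 - x c ^ 2) / 2)]
    exact Finset.prod_congr rfl fun c _ => by simp; ring
  have hmax : ∑ ε, max (p ε) (q ε) ≤ 2 := by
    calc ∑ ε, max (p ε) (q ε) ≤ ∑ ε, (p ε + q ε) :=
          Finset.sum_le_sum fun ε _ => max_le (by linarith [hq ε]) (by linarith [hp ε])
      _ = 2 := by
          rw [Finset.sum_add_distrib, sum_prod_signWeight, sum_prod_signWeight]; norm_num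
  have hmin : 0 ≤ ∑ ε, min (p ε) (q ε) := Finset.sum_nonneg fun ε _ => le_min (hp ε) (hq ε)
  rw [hr, ← Finset.prod_pow, Finset.prod_congr rfl fun c _ => Real.sq_sqrt (hx2 c)] at hcs
  nlinarith

lemma one_sub_sum_le_prod {ι : Type*} (S : Finset ι) (y : ι → ℝ) (h0 : ∀ i, 0 ≤ y i)
    (h1 : ∀ i, y i ≤ 1) : 1 - ∑ i ∈ S, y i ≤ ∏ i ∈ S, (1 - y i) := by
  classical
  induction S using Finset.induction_on with
  | empty => simp
  | insert a S ha ih =>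
    rw [Finset.sum_insert ha, Finset.prod_insert ha]
    have hP : ∏ i ∈ S, (1 - y i) ≤ 1 :=
      Finset.prod_le_one (fun i _ => by linarith [h1 i]) fun i _ => by linarith [h0 i]
    nlinarith [h0 a, h1 a]

/-- A cell visited repeatedly reveals its sign only once, so the product runs over the image;
counting repetitions in the sum only weakens the bound. -/
lemma one_sub_sum_le_prod_image {C : Type*} [DecidableEq C] {n : ℕ} (d : Fin n → C) (y : C → ℝ) (h0 : ∀ c, 0 ≤ y c)
    (h1 : ∀ c, y c ≤ 1) :
    1 - ∑ i, y (d i) ≤ ∏ c ∈ Finset.univ.image d, (1 - y c) := by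
  refine le_trans ?_ (one_sub_sum_le_prod _ y h0 h1)
  have : ∑ c ∈ Finset.univ.image d, y c ≤ ∑ i, y (d i) :=
    Finset.sum_image_le_of_nonneg (fun c _ => h0 c)
  linarith

/-- The variance of a linear form in independent signs. -/
lemma sum_prod_signWeight_mul_sq_le (x v : C → ℝ) :
    ∑ ε : C → Bool, (∏ c, signWeight (x c) (ε c)) *
      (∑ c, v c * (boolSign (ε c) - x c)) ^ 2 ≤ ∑ c, v c ^ 2 := by
  -- Writing each centred sign as a product of `if`s lets the expectation factor over coordinates.
  have hcross : ∀ c c' : C, ∑ ε : C → Bool, (∏ k, signWeight (x k) (ε k)) *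
      ((v c * (boolSign (ε c) - x c)) * (v c' * (boolSign (ε c') - x c'))) =
      ∏ k, ∑ b, signWeight (x k) b * ((if k = c then v k * (boolSign b - x k) else 1) *
        (if k = c' then v k * (boolSign b - x k) else 1)) := by
    intro c c'
    rw [← sum_fun_prod]
    refine Finset.sum_congr rfl fun ε _ => ?_
    simp only [Finset.prod_mul_distrib, Finset.prod_ite_eq', Finset.mem_univ, if_true]
  have hoff : ∀ c c' : C, c' ≠ c → ∑ ε : C → Bool, (∏ k, signWeight (x k) (ε k)) *
      ((v c * (boolSign (ε c) - x c)) * (v c' * (boolSign (ε c') - x c'))) = 0 := by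
    intro c c' hcc
    rw [hcross]
    refine Finset.prod_eq_zero (Finset.mem_univ c) ?_
    simpa [hcc.symm] using sum_signWeight_mul_sub (v c) (x c)
  have hdiag : ∀ c : C, ∑ ε : C → Bool, (∏ k, signWeight (x k) (ε k)) *
      ((v c * (boolSign (ε c) - x c)) * (v c * (boolSign (ε c) - x c))) ≤ v c ^ 2 := by
    intro c
    rw [hcross, Finset.prod_eq_single c]
    · simpa [← pow_two] using sum_signWeight_mul_sub_sq_le (v c) (x c)
    · intro k _ hk
      simpa [hk] using sum_signWeight (x k)
    · simp
  calc _ = ∑ c, ∑ c', ∑ ε : C → Bool, (∏ k, signWeight (x k) (ε k)) *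
      ((v c * (boolSign (ε c) - x c)) * (v c' * (boolSign (ε c') - x c'))) := by
        rw [Finset.sum_congr rfl fun ε _ => by
          rw [pow_two, Finset.sum_mul_sum, Finset.mul_sum]]
        rw [Finset.sum_comm]
        refine Finset.sum_congr rfl fun c _ => ?_
        rw [Finset.sum_comm]
        simp_rw [Finset.mul_sum]
    _ ≤ ∑ c, v c ^ 2 := by
        refine Finset.sum_le_sum fun c _ => ?_
        rw [Finset.sum_eq_single c (fun c' _ h => hoff c c' h) (by simp)]
        exact hdiag c

/-- The mean of an additive statistic of `n` independent draws from `w`. -/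
lemma sum_prod_mul_sum {C : Type*} [Fintype C] {n : ℕ} (w f : C → ℝ) (hw : ∑ c, w c = 1) :
    ∑ d : Fin n → C, (∏ i, w (d i)) * ∑ i, f (d i) = n * ∑ c, w c * f c := by
  have h1 : ∀ i : Fin n, ∑ d : Fin n → C, (∏ k, w (d k)) * f (d i) = ∑ c, w c * f c := by
    intro i
    have h2 : ∀ d : Fin n → C, (∏ k, w (d k)) * f (d i) =
        ∏ k, w (d k) * (if k = i then f (d k) else 1) := by
      intro d
      rw [Finset.prod_mul_distrib, Finset.prod_ite_eq', if_pos (Finset.mem_univ i)]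
    rw [Finset.sum_congr rfl fun d _ => h2 d, ← Fintype.piFinset_univ,
      ← Finset.prod_univ_sum (fun _ => Finset.univ)
        (fun k c => w c * (if k = i then f c else 1)), Finset.prod_eq_single i]
    · simp
    · intro k _ hk
      simpa [hk] using hw
    · simp
  simp_rw [Finset.mul_sum]
  rw [Finset.sum_comm, Finset.sum_congr rfl fun i _ => h1 i]
  simp [Finset.mul_sum]

lemma sum_prod_weight {C : Type*} [Fintype C] {n : ℕ} (w : C → ℝ) (hw : ∑ c, w c = 1) :
    ∑ d : Fin n → C, ∏ i, w (d i) = 1 := by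
  rw [← Fintype.piFinset_univ, ← Finset.prod_univ_sum (fun _ => Finset.univ) (fun _ c => w c)]
  simp [hw]

/-- Used to trade the random target `τ` for its prior mean `m`. -/
lemma lintegral_sq_sub_le (Λ : Measure ℝ) [IsProbabilityMeasure Λ] (τ m : ℝ) :
    ∫⁻ t, ENNReal.ofReal ((t - m) ^ 2) ∂Λ ≤
      2 * ∫⁻ t, ENNReal.ofReal ((t - τ) ^ 2) ∂Λ + 2 * ENNReal.ofReal ((τ - m) ^ 2) := by
  calc ∫⁻ t, ENNReal.ofReal ((t - m) ^ 2) ∂Λ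
      ≤ ∫⁻ t, (2 * ENNReal.ofReal ((t - τ) ^ 2) + 2 * ENNReal.ofReal ((τ - m) ^ 2)) ∂Λ := by
        refine lintegral_mono fun t => ?_
        have h2 : (2 : ℝ≥0∞) = ENNReal.ofReal 2 := by simp
        rw [h2, ← ENNReal.ofReal_mul (by norm_num), ← ENNReal.ofReal_mul (by norm_num),
          ← ENNReal.ofReal_add (by positivity) (by positivity)]
        exact ENNReal.ofReal_le_ofReal (by nlinarith [sq_nonneg (t - τ - (τ - m))])
    _ = _ := by
        rw [lintegral_add_right _ measurable_const, lintegral_const_mul _ (by fun_prop)]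
        simp

/-- The two squares add up to `2 (t - m)² + 2 Δ²`: no guess is close to both targets. -/
lemma ofReal_le_lintegral_sq_add (Λ : Measure ℝ) [IsProbabilityMeasure Λ] (m Δ : ℝ) :
    ENNReal.ofReal (2 * Δ ^ 2) ≤ ∫⁻ t, ENNReal.ofReal ((t - (m + Δ)) ^ 2) ∂Λ +
      ∫⁻ t, ENNReal.ofReal ((t - (m - Δ)) ^ 2) ∂Λ := by
  rw [← lintegral_add_left (by fun_prop)]
  calc ENNReal.ofReal (2 * Δ ^ 2) = ∫⁻ _, ENNReal.ofReal (2 * Δ ^ 2) ∂Λ := by simp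
    _ ≤ _ := by
        refine lintegral_mono fun t => ?_
        rw [← ENNReal.ofReal_add (by positivity) (by positivity)]
        exact ENNReal.ofReal_le_ofReal (by nlinarith [sq_nonneg (t - m)])

lemma sum_ofReal_prod_signWeight (x : C → ℝ) (hx : ∀ c, |x c| ≤ 1) :
    ∑ ε : C → Bool, ENNReal.ofReal (∏ c, signWeight (x c) (ε c)) = 1 := by
  rw [← ENNReal.ofReal_sum_of_nonneg
    fun ε _ => Finset.prod_nonneg fun c _ => signWeight_nonneg (hx c) _, sum_prod_signWeight]
  simp

/-- Replacing the means off `S` by zero does not change the average of a function of the signs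
with index in `S`. -/
lemma sum_ofReal_signWeight_congr (S : Finset C) (x : C → ℝ) (hx : ∀ c, |x c| ≤ 1)
    (f : (C → Bool) → ℝ≥0∞) (hf : ∀ ε ε', (∀ c ∈ S, ε c = ε' c) → f ε = f ε') :
    ∑ ε, ENNReal.ofReal (∏ c, signWeight (x c) (ε c)) * f ε =
      ∑ ε, ENNReal.ofReal (∏ c, signWeight (if c ∈ S then x c else 0) (ε c)) * f ε := by
  have hx' : ∀ c, |if c ∈ S then x c else 0| ≤ 1 := fun c => by
    split_ifs
    exacts [hx c, by simp]
  have h1 : ∀ y : C → ℝ, (∀ c, |y c| ≤ 1) → ∀ c, ∑ b, ENNReal.ofReal (signWeight (y c) b) = 1 := by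
    intro y hy c
    rw [← ENNReal.ofReal_sum_of_nonneg fun b _ => signWeight_nonneg (hy c) b, sum_signWeight]
    simp
  have h2 : ∀ y : C → ℝ, (∀ c, |y c| ≤ 1) → ∀ ε : C → Bool,
      ENNReal.ofReal (∏ c, signWeight (y c) (ε c)) =
        ∏ c, ENNReal.ofReal (signWeight (y c) (ε c)) := fun y hy ε =>
    ENNReal.ofReal_prod_of_nonneg fun c _ => signWeight_nonneg (hy c) _
  simp_rw [h2 x hx, h2 _ hx']
  refine sum_prod_mul_congr S _ _ (h1 x hx) (h1 _ hx') (fun c hc => ?_) f hf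
  simp [hc]

/-- Le Cam's bound for the two product priors with opposite means, given the design `d`. -/
lemma ofReal_le_sum_of_design {n : ℕ} (d : Fin n → C) (h : C → ℝ) (hh : ∀ c, |h c| ≤ 1)
    (m Δ : ℝ) (Λ : (C → Bool) → Measure ℝ) [∀ ε, IsProbabilityMeasure (Λ ε)]
    (hΛ : ∀ ε ε', (∀ i, ε (d i) = ε' (d i)) → Λ ε = Λ ε') :
    ENNReal.ofReal (Δ ^ 2 * (1 - ∑ i, h (d i) ^ 2)) ≤
      ∑ ε, ENNReal.ofReal (∏ c, signWeight (h c) (ε c)) *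
          ∫⁻ t, ENNReal.ofReal ((t - (m + Δ)) ^ 2) ∂(Λ ε) +
        ∑ ε, ENNReal.ofReal (∏ c, signWeight (-h c) (ε c)) *
          ∫⁻ t, ENNReal.ofReal ((t - (m - Δ)) ^ 2) ∂(Λ ε) := by
  set S : Finset C := Finset.univ.image d
  have hΛS : ∀ ε ε', (∀ c ∈ S, ε c = ε' c) → Λ ε = Λ ε' := fun ε ε' he =>
    hΛ ε ε' fun i => he _ (Finset.mem_image_of_mem d (Finset.mem_univ i))
  -- Unvisited signs carry no information; with mean zero they contribute a factor one to the
  -- affinity.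
  set x : C → ℝ := fun c => if c ∈ S then h c else 0 with hxdef
  have hx : ∀ c, |x c| ≤ 1 := fun c => by
    simp only [hxdef]
    split_ifs
    exacts [hh c, by simp]
  have hneg : ∀ c, (if c ∈ S then -h c else 0) = -x c := fun c => by
    simp only [hxdef]
    split_ifs <;> simp
  rw [sum_ofReal_signWeight_congr S h hh _ fun ε ε' he => by rw [hΛS ε ε' he],
    sum_ofReal_signWeight_congr S (fun c => -h c) (by simpa using hh) _
      fun ε ε' he => by rw [hΛS ε ε' he], ← Finset.sum_add_distrib]
  simp_rw [hneg]
  have hmin := half_prod_le_sum_min x hx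
  have hprod : 1 - ∑ i, h (d i) ^ 2 ≤ ∏ c, (1 - x c ^ 2) := by
    refine (one_sub_sum_le_prod_image d (fun c => h c ^ 2) (fun c => sq_nonneg _)
      fun c => (sq_le_one_iff_abs_le_one _).2 (hh c)).trans (le_of_eq ?_)
    rw [← Finset.prod_subset (Finset.subset_univ S) (fun c _ hc => by simp [hxdef, hc])]
    exact Finset.prod_congr rfl fun c hc => by simp [hxdef, hc]
  calc ENNReal.ofReal (Δ ^ 2 * (1 - ∑ i, h (d i) ^ 2))
      ≤ ENNReal.ofReal ((∑ ε : C → Bool, min (∏ c, signWeight (x c) (ε c))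
          (∏ c, signWeight (-x c) (ε c))) * (2 * Δ ^ 2)) :=
        ENNReal.ofReal_le_ofReal (by nlinarith [sq_nonneg Δ])
    _ = ∑ ε : C → Bool, ENNReal.ofReal (min (∏ c, signWeight (x c) (ε c))
          (∏ c, signWeight (-x c) (ε c))) * ENNReal.ofReal (2 * Δ ^ 2) := by
        have h0 : ∀ ε : C → Bool, 0 ≤ min (∏ c, signWeight (x c) (ε c))
            (∏ c, signWeight (-x c) (ε c)) := fun ε =>
          le_min (Finset.prod_nonneg fun c _ => signWeight_nonneg (hx c) _)
            (Finset.prod_nonneg fun c _ => signWeight_nonneg (by simpa using hx c) _)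
        rw [ENNReal.ofReal_mul (Finset.sum_nonneg fun ε _ => h0 ε),
          ENNReal.ofReal_sum_of_nonneg fun ε _ => h0 ε, Finset.sum_mul]
    _ ≤ _ := by
        refine Finset.sum_le_sum fun ε _ => ?_
        grw [ofReal_le_lintegral_sq_add (Λ ε) m Δ, mul_add]
        gcongr
        · exact min_le_left _ _
        · exact min_le_right _ _

/-- The average over a product prior of the squared distance to the prior mean of the target is
controlled by the worst-case risk and the prior variance. -/
lemma sum_signWeight_mul_risk_le {n : ℕ} (w : C → ℝ) (hw0 : ∀ c, 0 ≤ w c)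
    (hw1 : ∑ c, w c = 1) (v : C → ℝ) (m : ℝ)
    (Λ : (Fin n → C) → (C → Bool) → Measure ℝ) [∀ d ε, IsProbabilityMeasure (Λ d ε)] (ρ : ℝ≥0∞)
    (hρ : ∀ ε : C → Bool, ∑ d : Fin n → C, ENNReal.ofReal (∏ i, w (d i)) *
      ∫⁻ t, ENNReal.ofReal ((t - (m + ∑ c, v c * boolSign (ε c))) ^ 2) ∂(Λ d ε) ≤ ρ)
    (x : C → ℝ) (hx : ∀ c, |x c| ≤ 1) :
    ∑ d : Fin n → C, ENNReal.ofReal (∏ i, w (d i)) *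
      ∑ ε : C → Bool, ENNReal.ofReal (∏ c, signWeight (x c) (ε c)) *
        ∫⁻ t, ENNReal.ofReal ((t - (m + ∑ c, v c * x c)) ^ 2) ∂(Λ d ε) ≤
      2 * ρ + 2 * ENNReal.ofReal (∑ c, v c ^ 2) := by
  have hW : ∑ d : Fin n → C, ENNReal.ofReal (∏ i, w (d i)) = 1 := by
    rw [← ENNReal.ofReal_sum_of_nonneg fun d _ => Finset.prod_nonneg fun i _ => hw0 _,
      sum_prod_weight w hw1, ENNReal.ofReal_one]
  have hrisk : ∀ ε : C → Bool, ∑ d : Fin n → C, ENNReal.ofReal (∏ i, w (d i)) *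
      ∫⁻ t, ENNReal.ofReal ((t - (m + ∑ c, v c * x c)) ^ 2) ∂(Λ d ε) ≤
      2 * ρ + 2 * ENNReal.ofReal ((∑ c, v c * (boolSign (ε c) - x c)) ^ 2) := by
    intro ε
    calc _ ≤ ∑ d : Fin n → C, ENNReal.ofReal (∏ i, w (d i)) *
          (2 * ∫⁻ t, ENNReal.ofReal ((t - (m + ∑ c, v c * boolSign (ε c))) ^ 2) ∂(Λ d ε) +
            2 * ENNReal.ofReal ((∑ c, v c * (boolSign (ε c) - x c)) ^ 2)) := by
          refine Finset.sum_le_sum fun d _ => ?_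
          gcongr
          refine (lintegral_sq_sub_le _ (m + ∑ c, v c * boolSign (ε c)) _).trans (le_of_eq ?_)
          rw [add_sub_add_left_eq_sub, ← Finset.sum_sub_distrib]
          simp_rw [mul_sub]
      _ = 2 * ∑ d : Fin n → C, ENNReal.ofReal (∏ i, w (d i)) *
            ∫⁻ t, ENNReal.ofReal ((t - (m + ∑ c, v c * boolSign (ε c))) ^ 2) ∂(Λ d ε) +
            2 * ENNReal.ofReal ((∑ c, v c * (boolSign (ε c) - x c)) ^ 2) := by
          simp_rw [mul_add]
          rw [Finset.sum_add_distrib, ← Finset.sum_mul, hW, one_mul, Finset.mul_sum]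
          simp_rw [mul_left_comm]
      _ ≤ _ := by
          gcongr
          exact hρ ε
  calc _ = ∑ ε : C → Bool, ENNReal.ofReal (∏ c, signWeight (x c) (ε c)) *
        ∑ d : Fin n → C, ENNReal.ofReal (∏ i, w (d i)) *
          ∫⁻ t, ENNReal.ofReal ((t - (m + ∑ c, v c * x c)) ^ 2) ∂(Λ d ε) := by
        simp_rw [Finset.mul_sum]
        rw [Finset.sum_comm]
        simp_rw [mul_left_comm]
    _ ≤ ∑ ε : C → Bool, ENNReal.ofReal (∏ c, signWeight (x c) (ε c)) *
        (2 * ρ + 2 * ENNReal.ofReal ((∑ c, v c * (boolSign (ε c) - x c)) ^ 2)) := by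
        refine Finset.sum_le_sum fun ε _ => ?_
        gcongr
        exact hrisk ε
    _ = 2 * ρ + 2 * ∑ ε : C → Bool, ENNReal.ofReal (∏ c, signWeight (x c) (ε c)) *
        ENNReal.ofReal ((∑ c, v c * (boolSign (ε c) - x c)) ^ 2) := by
        simp_rw [mul_add]
        rw [Finset.sum_add_distrib, ← Finset.sum_mul, sum_ofReal_prod_signWeight x hx, one_mul,
          Finset.mul_sum]
        simp_rw [mul_left_comm]
    _ ≤ _ := by
        have h0 : ∀ ε : C → Bool, 0 ≤ ∏ c, signWeight (x c) (ε c) := fun ε =>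
          Finset.prod_nonneg fun c _ => signWeight_nonneg (hx c) _
        gcongr
        simp_rw [← ENNReal.ofReal_mul (h0 _)]
        rw [← ENNReal.ofReal_sum_of_nonneg fun ε _ => mul_nonneg (h0 ε) (sq_nonneg _)]
        exact ENNReal.ofReal_le_ofReal (sum_prod_signWeight_mul_sq_le x v)

/-- Two fuzzy hypotheses: a lower bound on the worst-case risk `ρ` of estimating a linear form in
unknown signs, when `n` independently drawn coordinates are observed. -/
theorem ofReal_le_worst_risk {n : ℕ} (w : C → ℝ) (hw0 : ∀ c, 0 ≤ w c)
    (hw1 : ∑ c, w c = 1) (v : C → ℝ) (m : ℝ)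
    (Λ : (Fin n → C) → (C → Bool) → Measure ℝ) [∀ d ε, IsProbabilityMeasure (Λ d ε)]
    (hΛ : ∀ d ε ε', (∀ i, ε (d i) = ε' (d i)) → Λ d ε = Λ d ε') (ρ : ℝ≥0∞)
    (hρ : ∀ ε : C → Bool, ∑ d : Fin n → C, ENNReal.ofReal (∏ i, w (d i)) *
      ∫⁻ t, ENNReal.ofReal ((t - (m + ∑ c, v c * boolSign (ε c))) ^ 2) ∂(Λ d ε) ≤ ρ)
    (h : C → ℝ) (hh : ∀ c, |h c| ≤ 1) :
    ENNReal.ofReal ((∑ c, v c * h c) ^ 2 * (1 - n * ∑ c, w c * h c ^ 2)) ≤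
      4 * ρ + 4 * ENNReal.ofReal (∑ c, v c ^ 2) := by
  have hW0 : ∀ d : Fin n → C, 0 ≤ ∏ i, w (d i) := fun d => Finset.prod_nonneg fun i _ => hw0 _
  have hplus := sum_signWeight_mul_risk_le w hw0 hw1 v m Λ ρ hρ h hh
  have hminus := sum_signWeight_mul_risk_le w hw0 hw1 v m Λ ρ hρ (fun c => -h c)
    (by simpa using hh)
  simp only [mul_neg, Finset.sum_neg_distrib, ← sub_eq_add_neg] at hminus
  set Δ := ∑ c, v c * h c
  calc ENNReal.ofReal (Δ ^ 2 * (1 - n * ∑ c, w c * h c ^ 2))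
      = ENNReal.ofReal (∑ d : Fin n → C, (∏ i, w (d i)) *
          (Δ ^ 2 * (1 - ∑ i, h (d i) ^ 2))) := by
        congr 1
        simp_rw [mul_left_comm _ (Δ ^ 2), ← Finset.mul_sum, mul_sub, mul_one]
        rw [Finset.sum_sub_distrib, sum_prod_weight w hw1,
          sum_prod_mul_sum w (fun c => h c ^ 2) hw1]
        ring
    _ ≤ ∑ d : Fin n → C, ENNReal.ofReal (∏ i, w (d i)) *
          ENNReal.ofReal (Δ ^ 2 * (1 - ∑ i, h (d i) ^ 2)) := by
        -- Only subadditivity is available: the summand is negative for designs with `∑ h² > 1`.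
        simp_rw [← ENNReal.ofReal_mul (hW0 _)]
        refine Finset.le_sum_of_subadditive _ ENNReal.ofReal_zero.le
          (fun a b => ENNReal.ofReal_add_le) _ _
    _ ≤ _ := by
        grw [Finset.sum_le_sum fun d _ => mul_le_mul_right
          (ofReal_le_sum_of_design d h hh m Δ (Λ d) (hΛ d)) _]
        simp_rw [mul_add]
        rw [Finset.sum_add_distrib]
        grw [hplus, hminus]
        refine le_of_eq ?_
        ring

end FiniteBayes

/-! ### Shattering by a convex class -/

/-- The values on a shattered sequence of the members of a convex class fill a cube. -/
lemma exists_mem_apply_eq_of_shatters {X : Type*} {H : Set (X → ℝ)} (hH : Convex ℝ H) {δ : ℝ}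
    {N : ℕ} {s : Fin N → X} {t : Fin N → ℝ}
    (ht : ∀ S : Set (Fin N), ∃ f ∈ H,
      (∀ i ∈ S, t i + δ ≤ f (s i)) ∧ (∀ i ∉ S, f (s i) ≤ t i - δ))
    (u : Fin N → ℝ) (hu : ∀ i, |u i| ≤ δ) :
    ∃ f ∈ H, ∀ i, f (s i) = t i + u i := by
  choose f hfH hfge hfle using ht
  let ev : (X → ℝ) →ₗ[ℝ] (Fin N → ℝ) := LinearMap.funLeft ℝ ℝ s
  set P : Set (Fin N → ℝ) := Set.range fun S => ev (f S)
  have hPsub : convexHull ℝ P ⊆ ev '' H :=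
    convexHull_min (by rintro _ ⟨S, rfl⟩; exact ⟨_, hfH S, rfl⟩) (hH.linear_image ev)
  suffices hmem : t + u ∈ convexHull ℝ P by
    obtain ⟨F, hF, hFe⟩ := hPsub hmem
    exact ⟨F, hF, fun i => congrFun hFe i⟩
  by_contra hnot
  have hclosed : IsClosed (convexHull ℝ P) := (Set.finite_range _).isClosed_convexHull ℝ
  obtain ⟨L, r, hlt, hgt⟩ :=
    geometric_hahn_banach_closed_point (convex_convexHull ℝ P) hclosed hnot
  -- The vertex chosen by the signs of the separating functional has `L`-value at least that of
  -- every cube point, contradicting separation.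
  set S : Set (Fin N) := {i | 0 ≤ L (Pi.single i 1)}
  have hS := hlt _ (subset_convexHull ℝ P ⟨S, rfl⟩)
  have hL : ∀ y : Fin N → ℝ, L y = ∑ i, y i * L (Pi.single i 1) := by
    intro y
    conv_lhs => rw [pi_eq_sum_univ' y]
    simp [map_sum]
  have : L (t + u) ≤ L (ev (f S)) := by
    rw [hL, hL]
    refine Finset.sum_le_sum fun i _ => ?_
    have hui := abs_le.1 (hu i)
    by_cases hi : i ∈ S
    · refine mul_le_mul_of_nonneg_right ?_ hi
      change t i + u i ≤ f S (s i)
      linarith [hfge S i hi]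
    · have hi' : L (Pi.single i 1) ≤ 0 := (not_le.1 hi).le
      refine mul_le_mul_of_nonpos_right ?_ hi'
      change f S (s i) ≤ t i + u i
      linarith [hfle S i hi]
  linarith

/-! ### The sampling law as a mixture over cells -/

section Measures

/-- A product of finite mixtures is the mixture of the products. -/
lemma pi_sum_smul {C Ω : Type*} [Fintype C] [MeasurableSpace Ω] (n : ℕ) (w : C → ℝ)
    (hw : ∀ c, 0 ≤ w c) (ν : C → Measure Ω) [∀ c, IsProbabilityMeasure (ν c)] :
    (Measure.pi fun _ : Fin n => ∑ c, ENNReal.ofReal (w c) • ν c) =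
      ∑ d : Fin n → C, ENNReal.ofReal (∏ i, w (d i)) • Measure.pi fun i => ν (d i) := by
  classical
  have : IsFiniteMeasure (∑ c, ENNReal.ofReal (w c) • ν c) :=
    ⟨by simp [Measure.finsetSum_apply, ENNReal.sum_lt_top]⟩
  refine Measure.pi_eq fun S _ => ?_
  simp only [Measure.finsetSum_apply, Measure.smul_apply, smul_eq_mul, Measure.pi_pi]
  rw [Finset.prod_univ_sum, Fintype.piFinset_univ]
  refine Finset.sum_congr rfl fun d _ => ?_
  rw [ENNReal.ofReal_prod_of_nonneg fun i _ => hw _, Finset.prod_mul_distrib]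

variable {X A : Type*} [MeasurableSpace X] [MeasurableSpace A]

lemma lintegral_uniformLaw {N : ℕ} (s : Fin N → X) {f : X → ℝ≥0∞} (hf : Measurable f) :
    ∫⁻ x, f x ∂(uniformLaw s) = ∑ j, ENNReal.ofReal (1 / N) * f (s j) := by
  rw [uniformLaw, lintegral_map hf (measurable_of_finite s), lintegral_fintype]
  refine Finset.sum_congr rfl fun j _ => ?_
  rw [mul_comm]
  congr 1
  have hN : 0 < N := j.pos
  rw [uniformOn, cond_apply MeasurableSet.univ]
  simp [ENNReal.ofReal_inv_of_pos, hN]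

lemma isProbabilityMeasure_uniformLaw {N : ℕ} (hN : 0 < N) (s : Fin N → X) :
    IsProbabilityMeasure (uniformLaw s) := by
  have : Nonempty (Fin N) := ⟨⟨0, hN⟩⟩
  have : IsProbabilityMeasure (uniformOn (Set.univ : Set (Fin N))) :=
    isProbabilityMeasure_uniformOn Set.finite_univ Set.univ_nonempty
  exact Measure.isProbabilityMeasure_map (measurable_of_finite s).aemeasurable

/-- The mass of the cell `(s j, a)` when the state is uniform on the sequence `s`. -/
noncomputable def cellWeight (π : Kernel X A) {N : ℕ} (s : Fin N → X) (c : Fin N × A) : ℝ :=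
  1 / N * propensity π (s c.1) c.2

lemma cellWeight_nonneg (π : Kernel X A) {N : ℕ} (s : Fin N → X) (c : Fin N × A) :
    0 ≤ cellWeight π s c :=
  mul_nonneg (by positivity) measureReal_nonneg

variable [Fintype A] [MeasurableSingletonClass A]

lemma sum_propensity (π : Kernel X A) [IsMarkovKernel π] (x : X) :
    ∑ a, propensity π x a = 1 := by
  simp [propensity, sum_measureReal_singleton]

lemma sum_cellWeight (π : Kernel X A) [IsMarkovKernel π] {N : ℕ} (hN : 0 < N) (s : Fin N → X) :
    ∑ c, cellWeight π s c = 1 := by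
  simp_rw [Fintype.sum_prod_type, cellWeight, ← Finset.mul_sum, sum_propensity]
  have : (N : ℝ) ≠ 0 := by positivity
  simp [this]

lemma uniformLaw_compProd (π : Kernel X A) [IsMarkovKernel π] {N : ℕ} (hN : 0 < N)
    (s : Fin N → X) :
    uniformLaw s ⊗ₘ π =
      ∑ c : Fin N × A, ENNReal.ofReal (cellWeight π s c) • Measure.dirac (s c.1, c.2) := by
  have := isProbabilityMeasure_uniformLaw hN s
  ext S hS
  rw [Measure.compProd_apply hS, lintegral_uniformLaw s (Kernel.measurable_kernel_prodMk_left hS),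
    Measure.finsetSum_apply, Fintype.sum_prod_type]
  refine Finset.sum_congr rfl fun j _ => ?_
  rw [← lintegral_indicator_one (measurable_prodMk_left hS), lintegral_fintype, Finset.mul_sum]
  refine Finset.sum_congr rfl fun a _ => ?_
  rw [cellWeight, ENNReal.ofReal_mul (by positivity), propensity, ofReal_measureReal,
    Measure.smul_apply, Measure.dirac_apply' _ hS, smul_eq_mul, mul_assoc]
  congr 1
  rw [mul_comm]
  rfl

/-- The law of one observation, given that its state and action are `s c.1` and `c.2` and that
the outcome function has the value `m` there. -/
noncomputable def cellLaw (K : Kernel (X × A × ℝ) ℝ) {N : ℕ} (s : Fin N → X) (c : Fin N × A)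
    (m : ℝ) : Measure ((X × A) × ℝ) :=
  (K (s c.1, c.2, m)).map (Prod.mk (s c.1, c.2))

instance (K : Kernel (X × A × ℝ) ℝ) [IsMarkovKernel K] {N : ℕ} (s : Fin N → X) (c : Fin N × A)
    (m : ℝ) : IsProbabilityMeasure (cellLaw K s c m) :=
  Measure.isProbabilityMeasure_map measurable_prodMk_left.aemeasurable

/-- The mixture weights are free of `μ`, and each component sees `μ` only at its own cell. -/
lemma observationLaw_uniformLaw (π : Kernel X A) [IsMarkovKernel π] (K : Kernel (X × A × ℝ) ℝ)
    [IsMarkovKernel K] {N : ℕ} (hN : 0 < N) (s : Fin N → X) (μ : X × A → ℝ) (hμ : Measurable μ) :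
    observationLaw π K (uniformLaw s) μ hμ =
      ∑ c : Fin N × A, ENNReal.ofReal (cellWeight π s c) • cellLaw K s c (μ (s c.1, c.2)) := by
  have := isProbabilityMeasure_uniformLaw hN s
  have : IsMarkovKernel (outcomeKernel K μ hμ) := by unfold outcomeKernel; infer_instance
  ext S hS
  have hmeas := Kernel.measurable_kernel_prodMk_left (κ := outcomeKernel K μ hμ) hS
  rw [observationLaw, Measure.compProd_apply hS, uniformLaw_compProd π hN, Measure.finsetSum_apply,
    lintegral_finsetSum_measure]
  refine Finset.sum_congr rfl fun c _ => ?_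
  rw [lintegral_smul_measure, lintegral_dirac' _ hmeas, Measure.smul_apply, cellLaw,
    Measure.map_apply measurable_prodMk_left hS]
  rfl

lemma integral_uniformLaw_compProd (π : Kernel X A) [IsMarkovKernel π] {N : ℕ} (hN : 0 < N)
    (s : Fin N → X) {f : X × A → ℝ} (hf : Measurable f) :
    ∫ p, f p ∂(uniformLaw s ⊗ₘ π) = ∑ c : Fin N × A, cellWeight π s c * f (s c.1, c.2) := by
  rw [uniformLaw_compProd π hN, integral_finsetSum_measure]
  · refine Finset.sum_congr rfl fun c _ => ?_
    rw [integral_smul_measure, integral_dirac' _ _ hf.stronglyMeasurable,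
      ENNReal.toReal_ofReal (cellWeight_nonneg π s c), smul_eq_mul]
  · intro c _
    exact (integrable_dirac' hf.stronglyMeasurable (by simp)).smul_measure ENNReal.ofReal_ne_top

lemma integrable_uniformLaw {N : ℕ} (s : Fin N → X) {f : X → ℝ} (hf : Measurable f) :
    Integrable f (uniformLaw s) := by
  have : IsFiniteMeasure (uniformOn (Set.univ : Set (Fin N))) := by
    unfold uniformOn; infer_instance
  rw [uniformLaw, integrable_map_measure hf.aestronglyMeasurable
    (measurable_of_finite s).aemeasurable]
  exact .of_finite

lemma integral_uniformLaw {N : ℕ} (s : Fin N → X) {f : X → ℝ} (hf : Measurable f) :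
    ∫ x, f x ∂(uniformLaw s) = ∑ j, 1 / N * f (s j) := by
  have : IsFiniteMeasure (uniformOn (Set.univ : Set (Fin N))) := by
    unfold uniformOn; infer_instance
  rw [uniformLaw, integral_map (measurable_of_finite s).aemeasurable hf.aestronglyMeasurable,
    integral_fintype .of_finite]
  refine Finset.sum_congr rfl fun j _ => ?_
  rw [smul_eq_mul]
  congr 1
  rw [Measure.real, uniformOn, cond_apply MeasurableSet.univ]
  simp

lemma measurable_propensity (π : Kernel X A) :
    Measurable fun p : X × A => propensity π p.1 p.2 :=
  measurable_from_prod_countable_left fun a =>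
    (Kernel.measurable_coe π (measurableSet_singleton a)).ennreal_toReal

end Measures

/-! ### Choice of the prior means -/

/-- The slightly clipped score: it has almost full correlation with `Z`, its second moment is at
most `1 / (2 n)`, and it takes values in `[-1, 1]`. -/
lemma exists_clipped_score {C : Type*} [Fintype C] (w Z : C → ℝ) (hw : ∀ c, 0 ≤ w c) {n : ℝ}
    (hn : 0 < n) (hV : 0 < ∑ c, w c * Z c ^ 2)
    (h4 : ∑ c, w c * Z c ^ 4 ≤ n * (∑ c, w c * Z c ^ 2) ^ 2) :
    ∃ h : C → ℝ, (∀ c, |h c| ≤ 1) ∧ n * ∑ c, w c * h c ^ 2 ≤ 1 / 2 ∧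
      (∑ c, w c * Z c ^ 2) / (8 * n) ≤ (∑ c, w c * Z c * h c) ^ 2 := by
  set V := ∑ c, w c * Z c ^ 2
  -- This scale gives `x = Z / T` second moment exactly `1 / (2 n)`; the hypothesis then bounds its
  -- fourth moment by half of that.
  set T := √(2 * n * V)
  have hT : 0 < T := by positivity
  have hT2 : T ^ 2 = 2 * n * V := Real.sq_sqrt (by positivity)
  set x : C → ℝ := fun c => Z c / T
  have hZ : ∀ c, Z c = T * x c := fun c => by simp only [x]; field_simp
  have hx2 : ∑ c, w c * x c ^ 2 = 1 / (2 * n) := by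
    have : ∀ c, w c * x c ^ 2 = w c * Z c ^ 2 / (2 * n * V) := fun c => by
      simp only [x]; rw [div_pow, hT2]; ring
    rw [Finset.sum_congr rfl fun c _ => this c, ← Finset.sum_div]
    change V / _ = _
    field_simp
  have hx4 : ∑ c, w c * x c ^ 4 ≤ 1 / (4 * n) := by
    have : ∀ c, w c * x c ^ 4 = w c * Z c ^ 4 / (2 * n * V) ^ 2 := fun c => by
      simp only [x]; rw [div_pow, ← hT2]; ring
    rw [Finset.sum_congr rfl fun c _ => this c, ← Finset.sum_div,
      div_le_div_iff₀ (by positivity) (by positivity)]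
    nlinarith
  have hden : ∀ c, 0 < 1 + x c ^ 2 := fun c => by positivity
  -- A smooth clip: `x² / (1 + x²) ≥ x² - x⁴`, so the correlation lost is controlled by the fourth
  -- moment.
  refine ⟨fun c => x c / (1 + x c ^ 2), fun c => ?_, ?_, ?_⟩
  · rw [abs_div, abs_of_pos (hden c), div_le_one (hden c), ← sq_abs (x c)]
    nlinarith [sq_nonneg (|x c| - 1), abs_nonneg (x c)]
  · have : ∑ c, w c * (x c / (1 + x c ^ 2)) ^ 2 ≤ ∑ c, w c * x c ^ 2 := by
      refine Finset.sum_le_sum fun c _ => mul_le_mul_of_nonneg_left ?_ (hw c)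
      rw [div_pow]
      refine div_le_self (sq_nonneg _) ?_
      nlinarith [sq_nonneg (x c)]
    rw [hx2] at this
    calc _ ≤ n * (1 / (2 * n)) := by gcongr
      _ = 1 / 2 := by field_simp
  · have hlow : T * (1 / (4 * n)) ≤ ∑ c, w c * Z c * (x c / (1 + x c ^ 2)) := by
      calc T * (1 / (4 * n)) ≤ T * (∑ c, w c * x c ^ 2 - ∑ c, w c * x c ^ 4) := by
            refine mul_le_mul_of_nonneg_left ?_ hT.le
            rw [hx2]
            have : 1 / (2 * n) = 1 / (4 * n) + 1 / (4 * n) := by field_simp; norm_num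
            linarith
        _ = ∑ c, w c * T * (x c ^ 2 - x c ^ 4) := by
            rw [← Finset.sum_sub_distrib, Finset.mul_sum]
            exact Finset.sum_congr rfl fun c _ => by ring
        _ ≤ _ := by
            refine Finset.sum_le_sum fun c _ => ?_
            rw [hZ c, show w c * (T * x c) * (x c / (1 + x c ^ 2)) =
              w c * T * (x c ^ 2 / (1 + x c ^ 2)) by ring]
            refine mul_le_mul_of_nonneg_left ?_ (mul_nonneg (hw c) hT.le)
            rw [le_div_iff₀ (hden c)]
            nlinarith [sq_nonneg (x c ^ 3)]
    calc V / (8 * n) = (T * (1 / (4 * n))) ^ 2 := by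
          rw [mul_pow, hT2]; field_simp; norm_num
      _ ≤ _ := by gcongr

/-! ### Reduction of the minimax risk to signs -/

/-- The risk of a randomized estimator under the uniform law on `s`, split according to the
cells that are visited. -/
lemma lintegral_comp_sampleLaw {X A : Type*} [MeasurableSpace X] [MeasurableSpace A]
    [Fintype A] [MeasurableSingletonClass A] (n : ℕ) (π : Kernel X A) [IsMarkovKernel π]
    (g : X × A → ℝ) (K : Kernel (X × A × ℝ) ℝ) [IsMarkovKernel K] (𝓕 : Set (X × A → ℝ))
    (κ : Kernel (Fin n → (X × A) × ℝ) ℝ) {N : ℕ} (hN : 0 < N) (s : Fin N → X)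
    (θ : ProblemInstance g 𝓕) (hθ : θ.ξ = uniformLaw s) {f : ℝ → ℝ≥0∞} (hf : Measurable f) :
    ∫⁻ t, f t ∂((κ ∘ₖ sampleLaw n π g K 𝓕) θ) =
      ∑ d : Fin n → Fin N × A, ENNReal.ofReal (∏ i, cellWeight π s (d i)) *
        ∫⁻ t, f t ∂((Measure.pi fun i =>
          cellLaw K s (d i) (θ.μ (s (d i).1, (d i).2))).bind κ) := by
  have hlaw : sampleLaw n π g K 𝓕 θ = ∑ d : Fin n → Fin N × A,
      ENNReal.ofReal (∏ i, cellWeight π s (d i)) •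
        Measure.pi fun i => cellLaw K s (d i) (θ.μ (s (d i).1, (d i).2)) := by
    change (Measure.pi fun _ : Fin n => observationLaw π K θ.ξ θ.μ θ.measurable) = _
    simp_rw [hθ, observationLaw_uniformLaw π K hN s θ.μ θ.measurable]
    exact pi_sum_smul n _ (cellWeight_nonneg π s) fun c => cellLaw K s c (θ.μ (s c.1, c.2))
  rw [Kernel.comp_apply, Measure.lintegral_bind κ.aemeasurable hf.aemeasurable, hlaw,
    lintegral_finsetSum_measure]
  refine Finset.sum_congr rfl fun d _ => ?_
  rw [lintegral_smul_measure, Measure.lintegral_bind κ.aemeasurable hf.aemeasurable, smul_eq_mul]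

lemma ofReal_le_of_four_mul {B R V : ℝ} {ρ : ℝ≥0∞} (hV : 0 ≤ V)
    (h : ENNReal.ofReal B ≤ 4 * ρ + 4 * ENNReal.ofReal V) (hR : 4 * R + 4 * V ≤ B) :
    ENNReal.ofReal R ≤ ρ := by
  rcases eq_or_ne ρ ⊤ with rfl | hρ
  · exact le_top
  lift ρ to NNReal using hρ
  rw [ENNReal.ofReal_le_iff_le_toReal ENNReal.coe_ne_top]
  have h4 : (4 : ℝ≥0∞) * ρ + 4 * ENNReal.ofReal V = ENNReal.ofReal (4 * ρ + 4 * V) := by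
    rw [ENNReal.ofReal_add (by positivity) (by positivity), ENNReal.ofReal_mul (by norm_num),
      ENNReal.ofReal_mul (by norm_num), ENNReal.ofReal_coe_nnreal]
    simp
  rw [h4, ENNReal.ofReal_le_ofReal_iff (by positivity)] at h
  simp only [ENNReal.coe_toReal]
  linarith

theorem mainTheorem4 :
    ∃ c : ℝ, 0 < c ∧ ∃ c' : ℝ, 0 < c' ∧
      ∀ (X : Type*) (A : Type*) [MeasurableSpace X] [Fintype A] [MeasurableSpace A]
        [MeasurableSingletonClass A]
        (π : Kernel X A) [IsMarkovKernel π]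
        (g : X × A → ℝ) (_ : Measurable g)
        (F : A → Set (X → ℝ)) (_ : ∀ a, Convex ℝ (F a)) (_ : ∀ a, ∀ f ∈ F a, Measurable f)
        (K : Kernel (X × A × ℝ) ℝ) [IsMarkovKernel K] (_ : IsOutcomeModel K (productClass F))
        (D : ℕ) (s : Fin D → X) (δ : A → ℝ) (_ : ∀ a, 0 ≤ δ a)
        (_ : ∀ a, FatShatters (F a) (δ a) s)
        (_ : ∀ j a, propensity π (s j) a = 0 → g (s j, a) = 0)
        (n : ℕ) (_ : 1 ≤ n)
        (_ : momentRatio (uniformLaw s ⊗ₘ π)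
          (fun p => g p / propensity π p.1 p.2 * δ p.2) ^ 2 ≤ n)
        (_ : (n : ℝ) ≤ c' * D),
        ENNReal.ofReal (c / n *
            (1 / D * ∑ j, ∑ a, g (s j, a) ^ 2 / propensity π (s j) a * δ a ^ 2)) ≤
          minimaxMSE n π g K (productClass F) := by
  -- The two-point bound gives `V / (16 n) ≤ 4 ρ + 4 V / D`; with `D ≥ 128 n` the last term is at
  -- most `V / (32 n)`, leaving `ρ ≥ V / (128 n)`.
  refine ⟨1 / 128, by norm_num, 1 / 128, by norm_num, ?_⟩
  intro X A _ _ _ _ π _ g hg F hconv hFmeas K _ _ D s δ hδ hshat hprop n hn hM hnD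
  classical
  have hnR : (1 : ℝ) ≤ n := by exact_mod_cast hn
  have hDR : (0 : ℝ) < D := by linarith
  have hD : 0 < D := by exact_mod_cast hDR
  set w : Fin D × A → ℝ := cellWeight π s
  have hw0 : ∀ c, 0 ≤ w c := cellWeight_nonneg π s
  have hw1 : ∑ c, w c = 1 := sum_cellWeight π hD s
  set Z : Fin D × A → ℝ := fun c => g (s c.1, c.2) / propensity π (s c.1) c.2 * δ c.2 with hZdef
  set v : Fin D × A → ℝ := fun c => 1 / D * (g (s c.1, c.2) * δ c.2) with hvdef
  have hp0 : ∀ x a, 0 ≤ propensity π x a := fun x a => measureReal_nonneg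
  have hp1 : ∀ x a, propensity π x a ≤ 1 := fun x a => measureReal_le_one
  -- Cells of zero propensity are where `g = 0` is needed: the target would otherwise involve values
  -- that are never observed.
  have hwZ : ∀ c, w c * Z c = v c := by
    intro c
    simp only [w, cellWeight, hZdef, hvdef]
    by_cases h0 : propensity π (s c.1) c.2 = 0
    · simp [h0, hprop _ _ h0]
    · field_simp
  have hwZ2 : ∀ c, w c * Z c ^ 2 =
      1 / D * (g (s c.1, c.2) ^ 2 / propensity π (s c.1) c.2 * δ c.2 ^ 2) := by
    intro c
    simp only [w, cellWeight, hZdef]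
    by_cases h0 : propensity π (s c.1) c.2 = 0
    · simp [h0]
    · field_simp
  set V : ℝ := ∑ c, w c * Z c ^ 2 with hVdef
  have hVeq : 1 / D * ∑ j, ∑ a, g (s j, a) ^ 2 / propensity π (s j) a * δ a ^ 2 = V := by
    simp only [hVdef, hwZ2]
    rw [Fintype.sum_prod_type, Finset.mul_sum]
    simp_rw [Finset.mul_sum]
  rw [hVeq]
  have hV0 : 0 ≤ V := Finset.sum_nonneg fun c _ => mul_nonneg (hw0 c) (sq_nonneg _)
  rcases hV0.eq_or_lt with hV | hV
  · simp [← hV]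
  -- `v² = w * (w Z²)`, and no cell has mass above `1 / D`.
  have hvV : ∑ c, v c ^ 2 ≤ V / D := by
    rw [hVdef, Finset.sum_div]
    refine Finset.sum_le_sum fun c _ => ?_
    have hle : w c ≤ 1 / D := mul_le_of_le_one_right (by positivity) (hp1 _ _)
    rw [← hwZ c, mul_pow, pow_two (w c), mul_assoc, div_eq_mul_one_div, mul_comm]
    exact mul_le_mul_of_nonneg_left hle (mul_nonneg (hw0 c) (sq_nonneg _))
  have h4 : ∑ c, w c * Z c ^ 4 ≤ n * V ^ 2 := by
    have hmeas : Measurable fun p : X × A => g p / propensity π p.1 p.2 * δ p.2 :=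
      (hg.div (measurable_propensity π)).mul ((measurable_of_finite δ).comp measurable_snd)
    rw [momentRatio, integral_uniformLaw_compProd π hD s (hmeas.pow_const 4),
      integral_uniformLaw_compProd π hD s (hmeas.pow_const 2)] at hM
    change (√(∑ c, w c * Z c ^ 4) / V) ^ 2 ≤ n at hM
    rwa [div_pow, Real.sq_sqrt (Finset.sum_nonneg fun c _ => mul_nonneg (hw0 c) (by positivity)),
      div_le_iff₀ (by positivity)] at hM
  obtain ⟨h, hh1, hh2, hh3⟩ := exists_clipped_score w Z hw0 (by linarith) hV h4
  choose t ht using hshat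
  have hδsign : ∀ a b, |δ a * boolSign b| ≤ δ a := fun a b => by
    cases b <;> simp [boolSign, abs_of_nonneg (hδ a)]
  -- The product structure of the class lets the sections be chosen separately for each action.
  choose f hfF hfval using fun (ε : Fin D × A → Bool) (a : A) =>
    exists_mem_apply_eq_of_shatters (hconv a) (ht a) (fun j => δ a * boolSign (ε (j, a)))
      fun j => hδsign a _
  have hμmeas : ∀ ε, Measurable fun p : X × A => f ε p.2 p.1 := fun ε =>
    measurable_from_prod_countable_left fun a => hFmeas a _ (hfF ε a)
  have hint : ∀ ε a, Measurable fun x => g (x, a) * f ε a x := fun ε a =>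
    (hg.comp measurable_prodMk_right).mul (hFmeas a _ (hfF ε a))
  let θ : (Fin D × A → Bool) → ProblemInstance g (productClass F) := fun ε =>
    { ξ := uniformLaw s
      μ := fun p => f ε p.2 p.1
      isProbabilityMeasure := isProbabilityMeasure_uniformLaw hD s
      measurable := hμmeas ε
      mem := fun a => hfF ε a
      integrable := fun a => integrable_uniformLaw s (hint ε a) }
  set m : ℝ := ∑ c : Fin D × A, 1 / D * (g (s c.1, c.2) * t c.2 c.1) with hmdef
  have htarget : ∀ ε, targetFunctional g (θ ε).ξ (θ ε).μ = m + ∑ c, v c * boolSign (ε c) := by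
    intro ε
    change ∑ a, ∫ x, g (x, a) * f ε a x ∂(uniformLaw s) = _
    simp_rw [integral_uniformLaw s (hint ε _), hfval]
    rw [hmdef, ← Finset.sum_add_distrib, Fintype.sum_prod_type_right]
    refine Finset.sum_congr rfl fun a _ => Finset.sum_congr rfl fun j _ => ?_
    simp only [hvdef]
    ring
  refine le_iInf₂ fun κ _ => ?_
  set ρ := ⨆ θ : ProblemInstance g (productClass F), ∫⁻ y,
    ENNReal.ofReal ((y - targetFunctional g θ.ξ θ.μ) ^ 2) ∂((κ ∘ₖ sampleLaw n π g K _) θ) with hρ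
  let Λ : (Fin n → Fin D × A) → (Fin D × A → Bool) → Measure ℝ := fun d ε =>
    (Measure.pi fun i => cellLaw K s (d i) ((θ ε).μ (s (d i).1, (d i).2))).bind κ
  have hΛprob : ∀ d ε, IsProbabilityMeasure (Λ d ε) := fun d ε => by
    simp only [Λ]
    infer_instance
  have hbound := ofReal_le_worst_risk w hw0 hw1 v m Λ
    (fun d ε ε' he => by
      have : ∀ i, (θ ε).μ (s (d i).1, (d i).2) = (θ ε').μ (s (d i).1, (d i).2) := fun i => by
        change f ε (d i).2 (s (d i).1) = f ε' (d i).2 (s (d i).1)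
        rw [hfval, hfval, he i]
      simp only [Λ, this]) ρ
    (fun ε => by
      rw [← lintegral_comp_sampleLaw n π g K (productClass F) κ hD s (θ ε) rfl
        (f := fun y => ENNReal.ofReal ((y - (m + ∑ c, v c * boolSign (ε c))) ^ 2))
        (by fun_prop), ← htarget ε]
      exact le_iSup (fun θ : ProblemInstance g (productClass F) => ∫⁻ y,
        ENNReal.ofReal ((y - targetFunctional g θ.ξ θ.μ) ^ 2) ∂((κ ∘ₖ sampleLaw n π g K _) θ))
        (θ ε)) h hh1
  refine ofReal_le_of_four_mul (Finset.sum_nonneg fun c _ => sq_nonneg (v c)) hbound ?_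
  simp_rw [hwZ] at hh3
  have hDn : V / D ≤ V / (128 * n) := by
    refine div_le_div_of_nonneg_left hV0 (by linarith) ?_
    linarith
  calc 4 * (1 / 128 / n * V) + 4 * ∑ c, v c ^ 2
      ≤ 4 * (1 / 128 / n * V) + 4 * (V / (128 * n)) := by linarith
    _ = V / (8 * n) * (1 / 2) := by field_simp; norm_num
    _ ≤ (∑ c, v c * h c) ^ 2 * (1 - n * ∑ c, w c * h c ^ 2) := by
        refine mul_le_mul hh3 (by linarith) (by norm_num) (sq_nonneg _)
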